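/- Let $\mathbb{K}$ be an algebraically closed field of characteristic different from $2$, let $V$ be an $N$-dimensional vector space over $\mathbb{K}$, and let $(\cdot,\cdot)$ be a non-degenerate symmetric bilinear form on $V$ (the orthogonal case, $\epsilon = 1$). Let $\mathfrak{k} \subseteq \mathfrak{gl}(V)$ be the Lie algebra of all $x$ with $(xu,v) = -(u,xv)$ for all $u,v \in V$, and let $\mathfrak{p} \subseteq \mathfrak{gl}(V)$ be the space of all $x$ with $(xu,v) = (u,xv)$ for all $u,v \in V$. Let $e \in \mathfrak{k}$ be nilpotent with Jordan block sizes $\lambda_1 \geq \dots \geq \lambda_n > 0$, let $\mathfrak{k}_e = \{x \in \mathfrak{k} : [x,e] = 0\}$ and $\mathfrak{p}_e = \{x \in \mathfrak{p} : [x,e] = 0\}$, and regard $\mathfrak{p}_e$ as a $\mathfrak{k}_e$-module through the commutator. Then the index $$\operatorname{ind}(\mathfrak{k}_e, \mathfrak{p}_e) := \min_{\alpha \in \mathfrak{p}_e^*} \dim\, \{x \in \mathfrak{k}_e : \alpha([x,y]) = 0 \text{ for all } y \in \mathfrak{p}_e\}$$ is given by $$\operatorname{ind}(\mathfrak{k}_e,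 \mathfrak{p}_e) = \frac{1}{2}\bigl(N - |\{i : \lambda_i \text{ odd}\}|\bigr).$$ -/

import Mathlib

open Module

-- The commutator bracket on an associative ring, in particular on `𝔤𝔩(V) = End K V`.
attribute [local instance 100] LieRing.ofAssociativeRing

namespace CentraliserIndex

section General

variable (K L M : Type*) [Field K] [LieRing L] [LieAlgebra K L]
  [AddCommGroup M] [Module K M] [LieRingModule L M] [LieModule K L M]

/-- The stabiliser `{x ∈ L | x • m = 0}` of an element `m` of an `L`-module `M`. -/
def stabiliser {M : Type*} [AddCommGroup M] [Module K M] [LieRingModule L M] [LieModule K L M]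
    (m : M) : LieSubalgebra K L where
  carrier := {x | ⁅x, m⁆ = 0}
  zero_mem' := by simp
  add_mem' := by
    intro x y hx hy
    simp only [Set.mem_ofPred_eq] at hx hy ⊢
    rw [add_lie, hx, hy, add_zero]
  smul_mem' := by
    intro c x hx
    simp only [Set.mem_ofPred_eq] at hx ⊢
    rw [smul_lie, hx, smul_zero]
  lie_mem' := by
    intro x y hx hy
    simp only [Set.mem_ofPred_eq] at hx hy ⊢
    rw [lie_lie, hx, hy, lie_zero, lie_zero, sub_zero]

/-- The index of a finite-dimensional Lie algebra `L` in an `L`-module `M`: the minimum of the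
dimensions of the stabilisers `L_α`, where `α` runs over the dual module `M^*` with its
contragredient action `(x • α) m = - α (x • m)`. (The infimum is that of a nonempty set of natural
numbers, so it is attained.) -/
noncomputable def index [FiniteDimensional K L] : ℕ :=
  ⨅ α : Dual K M, finrank K (stabiliser K L α)

end General

section Orthogonal

variable {K V : Type*} [Field K] [AddCommGroup V] [Module K V]

/-- `𝔨_e`: the endomorphisms `x` of `V` that are skew self-adjoint with respect to `B`,
`B (x u) v = - B u (x v)`, and commute with `e`, as a Lie subalgebra of `𝔤𝔩(V)`. -/
def kCentraliser (B : LinearMap.BilinForm K V) (e : End K V) : LieSubalgebra K (End K V) :=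
  skewAdjointLieSubalgebra B ⊓ stabiliser K (End K V) e

/-- `𝔭_e`: the endomorphisms `x` of `V` that are self-adjoint with respect to `B`,
`B (x u) v = B u (x v)` (equivalently, for nondegenerate `B`, the `-1`-eigenvectors of the
involution sending `x` to minus its adjoint), and commute with `e`, as a module over `𝔨_e` for the
commutator bracket of `𝔤𝔩(V)`. -/
def pCentraliser (B : LinearMap.BilinForm K V) (e : End K V) :
    LieSubmodule K (kCentraliser B e) (End K V) where
  toSubmodule := B.selfAdjointSubmodule ⊓ (stabiliser K (End K V) e).toSubmodule
  lie_mem := by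
    rintro ⟨x, hx⟩ y hy
    change y ∈ B.selfAdjointSubmodule ∧ y ∈ stabiliser K (End K V) e at hy
    change x ∈ B.skewAdjointSubmodule ∧ x ∈ stabiliser K (End K V) e at hx
    change ⁅x, y⁆ ∈ B.selfAdjointSubmodule ∧ ⁅x, y⁆ ∈ stabiliser K (End K V) e
    refine ⟨?_, LieSubalgebra.lie_mem _ hx.2 hy.2⟩
    have h1 : ∀ u v, B (x u) v = - B u (x v) := by
      intro u v
      have := (LinearMap.mem_skewAdjointSubmodule x).1 hx.1 u v
      simpa using this
    have h2 : ∀ u v, B (y u) v = B u (y v) := (LinearMap.mem_selfAdjointSubmodule y).1 hy.1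
    rw [LinearMap.mem_selfAdjointSubmodule]
    intro u v
    simp only [Ring.lie_def, LinearMap.sub_apply, End.mul_apply, map_sub, h1, h2]
    ring

/-- `lam 0 ≥ lam 1 ≥ ⋯ ≥ lam (n - 1) > 0` are the sizes of the Jordan blocks of the nilpotent
endomorphism `e`: there are vectors `w i` with `e ^ (lam i) (w i) = 0` such that the vectors
`e ^ s (w i)`, for `i < n` and `0 ≤ s < lam i`, form a basis of `V`. -/
def HasJordanPartition (e : End K V) {n : ℕ} (lam : Fin n → ℕ) : Prop :=
  Antitone lam ∧ (∀ i, 0 < lam i) ∧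
    ∃ w : Fin n → V, (∀ i, (e ^ lam i) (w i) = 0) ∧
      ∃ b : Basis (Σ i : Fin n, Fin (lam i)) K V, ∀ i s, b ⟨i, s⟩ = (e ^ (s : ℕ)) (w i)

end Orthogonal

end CentraliserIndex

/-! Extend a functional on `𝔭_e` to `f` on `𝔤𝔩(V)` vanishing on `𝔨_e`, and consider the form `f [x,
y]` on the centraliser `𝔤𝔩(V)_e = 𝔨_e ⊕ 𝔭_e`. Since `[𝔨, 𝔨]` and `[𝔭, 𝔭]` lie in `𝔨`, the form only
pairs `𝔨_e` with `𝔭_e`, so its radical is the sum of the two one-sided radicals. Their dimensions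
differ by `dim 𝔭_e - dim 𝔨_e`, which a count in a Jordan basis shows to be the number of odd blocks.
Hence the radical has dimension `2 dim (𝔨_e)_α + #odd` (`finrank_radical_eq`,
`finrank_signedCentraliser_zero`), and it remains to see that its minimum over all such `f` is `N`.

At least `N`: this is Vinberg's semicontinuity argument. Every endomorphism `e + t F` has a
centraliser of dimension at least `N`, and first-order deformation at `t = 0` carries the bound to
the radical (`finrank_le_finrank_radical`).

At most `N`: take `f x = ∑ B (v i) (x (w i))` for Jordan generators `w i` and a dual family `v i`,
arranged so that `f` kills skew maps and the numbers `B (v i) (e ^ (μ i - 1) (w i))` are distinct.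
This forces the radical to be block diagonal (`block_eq_zero`). Such families are built by splitting
`V` orthogonally into pieces with one or two generators. -/

namespace CentraliserIndex

/-! ### Lower bound for the radical by deforming `e`. -/

section Vinberg

open LinearMap

variable {K V W W' : Type*} [Field K] [AddCommGroup V] [Module K V]
  [AddCommGroup W] [Module K W] [AddCommGroup W'] [Module K W']

/-- The commutator map `y ↦ x y - y x`. -/
def commutatorMap (x : End K V) : End K V →ₗ[K] End K V :=
  mulLeft K x - mulRight K x

@[simp]
lemma commutatorMap_apply (x y : End K V) : commutatorMap x y = x * y - y * x := rfl

lemma mem_stabiliser_iff {x e : End K V} : x ∈ stabiliser K (End K V) e ↔ x * e = e * x := by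
  change ⁅x, e⁆ = 0 ↔ _
  rw [Ring.lie_def, sub_eq_zero]

open Polynomial in
/-- The centraliser of an endomorphism has dimension at least that of the space. -/
lemma finrank_le_finrank_ker_commutatorMap [FiniteDimensional K V] (x : End K V) :
    finrank K V ≤ finrank K (ker (commutatorMap x)) := by
  obtain ⟨ι, _, p, -, k, ⟨f⟩⟩ := Module.equiv_directSum_of_isTorsion
    (R := K[X]) (M := AEval' x) (AEval.isTorsion_of_finiteDimensional K V x)
  classical
  let g := f.trans (DirectSum.linearEquivFunOnFintype K[X] ι
    (fun i => K[X] ⧸ Submodule.span K[X] {p i ^ k i}))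
  -- `V` is identified with a commutative ring `A` on which `x` acts as `X`; multiplications by
  -- elements of `A` then embed `A` in the centraliser, as evaluation at `1` shows.
  let A := ∀ i, K[X] ⧸ Ideal.span {p i ^ k i}
  let φ : V ≃ₗ[K] A := (AEval'.of x).trans (g.restrictScalars K)
  have hφ : ∀ v, φ (x v) = (X : K[X]) • φ v := by
    intro v
    change g (AEval'.of x (x v)) = (X : K[X]) • g (AEval'.of x v)
    rw [← map_smul, AEval'.X_smul_of]
  have hφs : ∀ a : A, φ.symm ((X : K[X]) • a) = x (φ.symm a) := by
    intro a
    rw [LinearEquiv.symm_apply_eq, hφ, LinearEquiv.apply_symm_apply]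
  let m : A →ₗ[K] ker (commutatorMap x) := LinearMap.codRestrict _
    ((φ.symm.conj.toLinearMap).comp (LinearMap.mul K A)) (by
      intro a
      rw [mem_ker, commutatorMap_apply, sub_eq_zero]
      ext v
      change x (φ.symm (a * φ v)) = φ.symm (a * φ (x v))
      rw [hφ, ← hφs, mul_smul_comm])
  have hm : Function.Injective m := by
    intro a b hab
    have h := LinearMap.congr_fun (congrArg Subtype.val hab) (φ.symm 1)
    change φ.symm (a * φ (φ.symm 1)) = φ.symm (b * φ (φ.symm 1)) at h
    simpa using h
  rw [φ.finrank_eq]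
  exact LinearMap.finrank_le_finrank_of_injective hm

/-- If `l` is a left inverse of `f`, a nonzero kernel vector of `f + t • g` is an eigenvector of `l
∘ g` with eigenvalue `-t⁻¹`, and there are finitely many eigenvalues to avoid. -/
lemma exists_ne_zero_injective_add_smul [Infinite K] [FiniteDimensional K W]
    (f g : W →ₗ[K] W') (hf : Function.Injective f) :
    ∃ t : K, t ≠ 0 ∧ Function.Injective (f + t • g) := by
  obtain ⟨l, hl⟩ := f.exists_leftInverse_of_injective (ker_eq_bot.2 hf)
  let M : End K W := l ∘ₗ g
  obtain ⟨c, hc⟩ := ((Module.End.finite_hasEigenvalue M).insert 0).exists_notMem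
  simp only [Set.mem_insert_iff, Set.mem_ofPred_eq, not_or] at hc
  refine ⟨-c⁻¹, by simpa using hc.1, ?_⟩
  rw [← ker_eq_bot, ker_eq_bot']
  intro w hw
  by_contra hw0
  apply hc.2
  refine Module.End.hasEigenvalue_of_hasEigenvector (x := w) ⟨?_, hw0⟩
  rw [Module.End.mem_eigenspace_iff]
  have h := congrArg l hw
  have h1 : l (f w) = w := LinearMap.congr_fun hl w
  simp only [LinearMap.add_apply, LinearMap.smul_apply, map_add, map_smul, h1, map_zero] at h
  change l (g w) = c • w
  have h2 : c • (w + (-c⁻¹) • l (g w)) = 0 := by rw [h, smul_zero]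
  rw [smul_add, smul_smul, mul_neg, mul_inv_cancel₀ hc.1, neg_smul, one_smul] at h2
  exact (add_neg_eq_zero.1 h2).symm

/-- Semicontinuity of the kernel along a pencil of linear maps, to first order. -/
lemma le_finrank_ker_inf_comap_range [Infinite K] [FiniteDimensional K W] (f g : W →ₗ[K] W')
    {d : ℕ} (hd : ∀ t : K, t ≠ 0 → d ≤ finrank K (ker (f + t • g))) :
    d ≤ finrank K (ker f ⊓ (range f).comap g : Submodule K W) := by
  set S : Submodule K W := ker f ⊓ (range f).comap g
  obtain ⟨C₁, hC₁⟩ := (ker f).exists_isCompl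
  obtain ⟨C, hC⟩ := S.exists_isCompl
  -- `C₂` complements `S` in `ker f`, so `f` on `C₁` and `g` on `C₂` are jointly injective. For a
  -- suitable `t` this makes `f + t • g` injective on `C₁ ⊕ C₂`, of codimension `dim S`.
  let C₂ := C ⊓ ker f
  have hdis : ∀ u ∈ C₁, u ∈ ker f → u = 0 := fun u h1 h2 =>
    (Submodule.disjoint_def.1 hC₁.disjoint) u h2 h1
  have hdis' : ∀ v ∈ C₂, g v ∈ range f → v = 0 := fun v h1 h2 =>
    (Submodule.disjoint_def.1 hC.disjoint) v ⟨h1.2, h2⟩ h1.1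
  let Φ : (C₁ × C₂) →ₗ[K] W' := (f ∘ₗ C₁.subtype).coprod (g ∘ₗ C₂.subtype)
  let Ψ : (C₁ × C₂) →ₗ[K] W' := (g ∘ₗ C₁.subtype).coprod 0
  have hΦ : Function.Injective Φ := by
    rw [← ker_eq_bot, ker_eq_bot']
    rintro ⟨⟨u, hu⟩, ⟨v, hv⟩⟩ h
    change f u + g v = 0 at h
    have hv0 : v = 0 := hdis' v hv ⟨-u, by rw [map_neg, neg_eq_iff_add_eq_zero, h]⟩
    subst hv0
    rw [map_zero, add_zero] at h
    have hu0 : u = 0 := hdis u hu h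
    subst hu0
    rfl
  obtain ⟨t, ht, hinj⟩ := exists_ne_zero_injective_add_smul Φ Ψ hΦ
  rw [← ker_eq_bot, ker_eq_bot'] at hinj
  let I : (C₁ × C₂) →ₗ[K] W := C₁.subtype.coprod C₂.subtype
  have hker : ∀ z : C₁ × C₂, I z ∈ ker (f + t • g) → z = 0 := by
    rintro ⟨⟨u, hu⟩, ⟨v, hv⟩⟩ h
    change f (u + v) + t • g (u + v) = 0 at h
    have hfv : f v = 0 := hv.2
    -- As `f v = 0`, the factor `t` on `g v` can be absorbed by rescaling `v`.
    have := hinj (⟨u, hu⟩, t • ⟨v, hv⟩) (by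
      change (f u + g (t • v)) + t • (g u + 0) = 0
      refine Eq.trans ?_ h
      simp only [map_add, map_smul, hfv, smul_add, smul_zero]
      abel)
    simp only [Prod.mk_eq_zero, Submodule.mk_eq_zero, smul_eq_zero, ht, false_or] at this
    ext
    · exact this.1
    · exact this.2
  have hI : Function.Injective I := by
    rw [← ker_eq_bot, ker_eq_bot']
    intro z hz
    exact hker z (by rw [hz]; exact zero_mem _)
  have hdisj : Disjoint (ker (f + t • g)) (range I) := by
    rw [Submodule.disjoint_def]
    rintro _ hw ⟨z, rfl⟩
    rw [hker z hw, map_zero]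
  have h1 := Submodule.finrank_add_finrank_le_of_disjoint hdisj
  rw [finrank_range_of_inj hI, finrank_prod] at h1
  have h2 := Submodule.finrank_add_eq_of_isCompl hC₁
  have h3 : finrank K (ker f) = finrank K S + finrank K C₂ := by
    have h4 : S ⊔ C₂ = ker f := by
      rw [← _root_.sup_inf_assoc_of_le C (inf_le_left : S ≤ ker f), hC.sup_eq_top,
        top_inf_eq]
    have h5 : S ⊓ C₂ = ⊥ := by
      rw [eq_bot_iff, ← hC.inf_eq_bot]
      exact inf_le_inf_left _ inf_le_left
    have := Submodule.finrank_sup_add_finrank_inf_eq S C₂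
    rw [h4, h5, finrank_bot] at this
    omega
  have := hd t ht
  omega

/-- Every linear functional on `𝔤𝔩(V)` is of the form `x ↦ tr (F x)`. -/
lemma exists_eq_trace_mul [FiniteDimensional K V] (f : Dual K (End K V)) :
    ∃ F : End K V, ∀ x, f x = trace K V (F * x) := by
  let T : End K V →ₗ[K] Dual K (End K V) := (LinearMap.mul K (End K V)).compr₂ (trace K V)
  have hT : Function.Injective T := by
    rw [← ker_eq_bot, ker_eq_bot']
    intro F hF
    ext v
    rw [LinearMap.zero_apply, ← Module.forall_dual_apply_eq_zero_iff K]
    intro φ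
    have h : trace K V (F * φ.smulRight v) = 0 := LinearMap.congr_fun hF _
    have h2 : F * φ.smulRight v = φ.smulRight (F v) := by ext; simp
    rwa [h2, trace_smulRight] at h
  obtain ⟨F, hF⟩ := (LinearMap.injective_iff_surjective_of_finrank_eq_finrank
    (Subspace.dual_finrank_eq).symm).1 hT f
  exact ⟨F, fun x => by rw [← hF]; rfl⟩

/-- The radical, in the centraliser of `e`, of the form `(x, y) ↦ f [x, y]`. -/
def radical (e : End K V) (f : Dual K (End K V)) : Submodule K (End K V) where
  carrier := {x | Commute x e ∧ ∀ y, Commute y e → f (x * y - y * x) = 0}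
  zero_mem' := by simp
  add_mem' := by
    rintro a b ⟨ha, ha'⟩ ⟨hb, hb'⟩
    refine ⟨ha.add_left hb, fun y hy => ?_⟩
    rw [add_mul, mul_add, add_sub_add_comm, map_add, ha' y hy, hb' y hy, add_zero]
  smul_mem' := by
    rintro c a ⟨ha, ha'⟩
    refine ⟨ha.smul_left c, fun y hy => ?_⟩
    rw [smul_mul_assoc, mul_smul_comm, ← smul_sub, map_smul, ha' y hy, smul_zero]

/-- Vinberg's inequality for centralisers in `𝔤𝔩(V)`. -/
lemma finrank_le_finrank_radical [Infinite K] [FiniteDimensional K V] (e : End K V)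
    (f : Dual K (End K V)) : finrank K V ≤ finrank K (radical e f) := by
  obtain ⟨F, hF⟩ := exists_eq_trace_mul f
  have h := le_finrank_ker_inf_comap_range (commutatorMap e) (commutatorMap F) (d := finrank K V)
    (fun t _ => by
      have h1 : commutatorMap e + t • commutatorMap F = commutatorMap (e + t • F) := by
        ext1 x
        simp only [LinearMap.add_apply, LinearMap.smul_apply, commutatorMap_apply, add_mul,
          mul_add, smul_mul_assoc, mul_smul_comm, smul_sub]
        abel
      rw [h1]
      exact finrank_le_finrank_ker_commutatorMap _)
  refine h.trans (Submodule.finrank_mono ?_)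
  -- Here `[e, z] = [F, x]`, so `tr (F [x, y]) = tr ([e, z] y)`, which is `0` when `y` commutes with
  -- `e`.
  rintro x ⟨hx, z, hz⟩
  rw [SetLike.mem_coe, mem_ker, commutatorMap_apply, sub_eq_zero] at hx
  rw [commutatorMap_apply, commutatorMap_apply] at hz
  refine ⟨hx.symm, fun y hy => ?_⟩
  rw [hF]
  have h1 : trace K V (F * (x * y - y * x)) = trace K V ((F * x - x * F) * y) := by
    rw [mul_sub, sub_mul, map_sub, map_sub, ← mul_assoc, ← mul_assoc, trace_mul_comm K (F * y) x,
      mul_assoc x]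
  rw [h1, ← hz, sub_mul, map_sub, mul_assoc z, ← hy.eq, trace_mul_comm K (e * z) y,
    trace_mul_comm K z (y * e), mul_assoc, sub_self]

end Vinberg

/-! ### Splitting the centraliser and the radical into skew and self-adjoint parts. -/

section Decomposition

open LinearMap

variable {K V : Type*} [Field K] [AddCommGroup V] [Module K V]

lemma finrank_ker_add_finrank_eq_flip {X Y : Type*} [AddCommGroup X] [Module K X]
    [AddCommGroup Y] [Module K Y] [FiniteDimensional K X] [FiniteDimensional K Y]
    (P : X →ₗ[K] Y →ₗ[K] K) :
    finrank K (ker P) + finrank K Y = finrank K (ker P.flip) + finrank K X := by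
  have h1 := P.finrank_range_add_finrank_ker
  have h2 := P.flip.finrank_range_add_finrank_ker
  have h3 : P.flip = P.dualMap ∘ₗ (evalEquiv K Y).toLinearMap := by
    ext y x
    rfl
  have h4 : finrank K (range P.flip) = finrank K (range P) := by
    rw [h3, LinearEquiv.range_comp, finrank_range_dualMap_eq_finrank_range]
  omega

/-- The maps commuting with `e` and equal to `(-1) ^ r` times their adjoint with respect to `B`. -/
def signedCentraliser (B : LinearMap.BilinForm K V) (e : End K V) (r : ℕ) :
    Submodule K (End K V) where
  carrier := {x | (∀ u v, B (x u) v = (-1) ^ r * B u (x v)) ∧ Commute x e}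
  zero_mem' := by simp
  add_mem' := by
    rintro a b ⟨ha, ha'⟩ ⟨hb, hb'⟩
    refine ⟨fun u v => ?_, ha'.add_left hb'⟩
    simp only [LinearMap.add_apply, map_add, ha, hb]
    ring
  smul_mem' := by
    rintro c a ⟨ha, ha'⟩
    refine ⟨fun u v => ?_, ha'.smul_left c⟩
    simp only [LinearMap.smul_apply, map_smul, ha, smul_eq_mul]
    ring

variable {B : LinearMap.BilinForm K V} {e : End K V}

lemma mem_signedCentraliser {r : ℕ} {x : End K V} : x ∈ signedCentraliser B e r ↔
    (∀ u v, B (x u) v = (-1) ^ r * B u (x v)) ∧ Commute x e := Iff.rfl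

lemma mem_kCentraliser_iff {x : End K V} :
    x ∈ kCentraliser B e ↔ x ∈ signedCentraliser B e 1 := by
  rw [mem_signedCentraliser, commute_iff_eq, ← mem_stabiliser_iff]
  refine and_congr_left fun _ => ?_
  change x ∈ B.skewAdjointSubmodule ↔ _
  rw [LinearMap.mem_skewAdjointSubmodule]
  refine forall₂_congr fun u v => ?_
  simp

lemma mem_pCentraliser_iff {x : End K V} :
    x ∈ pCentraliser B e ↔ x ∈ signedCentraliser B e 0 := by
  rw [mem_signedCentraliser, commute_iff_eq, ← mem_stabiliser_iff]
  refine and_congr_left fun _ => ?_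
  change x ∈ B.selfAdjointSubmodule ↔ _
  rw [LinearMap.mem_selfAdjointSubmodule]
  refine forall₂_congr fun u v => ?_
  simp

/-- Adjoints reverse products, which gives a commutator one extra sign. Only the parity of the
exponent matters. -/
lemma commutator_mem_signedCentraliser {r s : ℕ} {x y : End K V}
    (hx : x ∈ signedCentraliser B e r) (hy : y ∈ signedCentraliser B e s) :
    x * y - y * x ∈ signedCentraliser B e (r + s + 1) := by
  refine ⟨fun u v => ?_, (hx.2.mul_left hy.2).sub_left (hy.2.mul_left hx.2)⟩
  simp only [LinearMap.sub_apply, End.mul_apply, map_sub, hx.1, hy.1]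
  ring

lemma disjoint_signedCentraliser (hK : (2 : K) ≠ 0) (hB : B.Nondegenerate) :
    Disjoint (signedCentraliser B e 1) (signedCentraliser B e 0) := by
  rw [Submodule.disjoint_def]
  intro x h1 h0
  ext u
  refine hB.1 _ fun v => ?_
  have h2 := h1.1 u v
  have h3 := h0.1 u v
  rw [pow_one, neg_one_mul] at h2
  rw [pow_zero, one_mul] at h3
  rw [← h3] at h2
  have : (2 : K) * B (x u) v = 0 := by linear_combination h2
  simpa [hK] using this

lemma exists_add_signedCentraliser [FiniteDimensional K V] (hK : (2 : K) ≠ 0) (hB : B.Nondegenerate)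
    (hsymm : B.IsSymm) (he : ∀ u v, B (e u) v = - B u (e v)) {x : End K V} (hx : Commute x e) :
    ∃ a ∈ signedCentraliser B e 1, ∃ b ∈ signedCentraliser B e 0, x = a + b := by
  let y : End K V := B.leftAdjointOfNondegenerate hB x
  have hy : ∀ u v, B (y u) v = B u (x v) :=
    LinearMap.BilinForm.isAdjointPairLeftAdjointOfNondegenerate B hB x
  have hy' : ∀ u v, B (x u) v = B u (y v) := fun u v => by
    rw [hsymm.eq, ← hy, hsymm.eq]
  have hye : Commute y e := by
    ext u
    refine sub_eq_zero.1 (hB.1 _ fun v => ?_)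
    have h1 : e (x v) = x (e v) := (LinearMap.congr_fun hx.eq v).symm
    simp only [End.mul_apply, map_sub, LinearMap.sub_apply, hy, he, h1, sub_self]
  refine ⟨(2 : K)⁻¹ • (x - y), ⟨fun u v => ?_, (hx.sub_left hye).smul_left _⟩,
    (2 : K)⁻¹ • (x + y), ⟨fun u v => ?_, (hx.add_left hye).smul_left _⟩, ?_⟩
  · simp only [LinearMap.smul_apply, LinearMap.sub_apply, map_smul, map_sub, hy, hy', smul_eq_mul]
    ring
  · simp only [LinearMap.smul_apply, LinearMap.add_apply, map_smul, map_add, hy, hy', smul_eq_mul]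
    ring
  · rw [← smul_add, sub_add_add_cancel, ← two_smul K x, smul_smul, inv_mul_cancel₀ hK, one_smul]

/-- The stabiliser of `f` in one signed centraliser, for the pairing with another one. -/
def signedRadical (B : LinearMap.BilinForm K V) (e : End K V) (f : Dual K (End K V)) (r s : ℕ) :
    Submodule K (End K V) where
  carrier := {x | x ∈ signedCentraliser B e r ∧
    ∀ y ∈ signedCentraliser B e s, f (x * y - y * x) = 0}
  zero_mem' := ⟨zero_mem _, by simp⟩
  add_mem' := by
    rintro a b ⟨ha, ha'⟩ ⟨hb, hb'⟩
    refine ⟨add_mem ha hb, fun y hy => ?_⟩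
    rw [add_mul, mul_add, add_sub_add_comm, map_add, ha' y hy, hb' y hy, add_zero]
  smul_mem' := by
    rintro c a ⟨ha, ha'⟩
    refine ⟨Submodule.smul_mem _ _ ha, fun y hy => ?_⟩
    rw [smul_mul_assoc, mul_smul_comm, ← smul_sub, map_smul, ha' y hy, smul_zero]

/-- The two radicals are the kernels of one pairing and its transpose, which have equal rank. -/
lemma finrank_signedRadical_add_finrank [FiniteDimensional K V] (f : Dual K (End K V)) (r s : ℕ) :
    finrank K (signedRadical B e f r s) + finrank K (signedCentraliser B e s) =
      finrank K (signedRadical B e f s r) + finrank K (signedCentraliser B e r) := by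
  let Q : End K V →ₗ[K] End K V →ₗ[K] K :=
    (LinearMap.mul K (End K V) - (LinearMap.mul K (End K V)).flip).compr₂ f
  let P := Q.domRestrict₁₂ (signedCentraliser B e r) (signedCentraliser B e s)
  have hP : ∀ x y, P x y = f (x.1 * y.1 - y.1 * x.1) := fun x y => rfl
  have h := finrank_ker_add_finrank_eq_flip P
  have h1 : (ker P).map (Submodule.subtype _) = signedRadical B e f r s := by
    ext x
    constructor
    · rintro ⟨x, hx, rfl⟩
      exact ⟨x.2, fun y hy => LinearMap.congr_fun hx (⟨y, hy⟩ : signedCentraliser B e s)⟩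
    · rintro ⟨hx, hx'⟩
      exact ⟨⟨x, hx⟩, LinearMap.ext fun y => hx' y y.2, rfl⟩
  have h2 : (ker P.flip).map (Submodule.subtype _) = signedRadical B e f s r := by
    ext x
    constructor
    · rintro ⟨x, hx, rfl⟩
      refine ⟨x.2, fun y hy => ?_⟩
      have h3 := LinearMap.congr_fun hx (⟨y, hy⟩ : signedCentraliser B e r)
      rw [LinearMap.flip_apply, hP, LinearMap.zero_apply] at h3
      rw [← neg_sub, map_neg, neg_eq_zero]
      exact h3
    · rintro ⟨hx, hx'⟩
      refine ⟨⟨x, hx⟩, LinearMap.ext fun y => ?_, rfl⟩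
      have h3 := hx' y y.2
      rw [LinearMap.flip_apply, hP, LinearMap.zero_apply]
      rw [← neg_sub, map_neg, neg_eq_zero]
      exact h3
  rw [← h1, ← h2, Submodule.finrank_map_subtype_eq, Submodule.finrank_map_subtype_eq]
  exact h

/-- Both diagonal parts of the form vanish: `f` kills `[𝔭_e, 𝔭_e]` (exponent `1`) and `[𝔨_e, 𝔨_e]`
(exponent `3`). -/
lemma finrank_radical_eq [FiniteDimensional K V] (hK : (2 : K) ≠ 0) (hB : B.Nondegenerate)
    (hsymm : B.IsSymm) (he : ∀ u v, B (e u) v = - B u (e v)) (f : Dual K (End K V))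
    (hf : ∀ x ∈ signedCentraliser B e 1, f x = 0) :
    finrank K (radical e f) =
      finrank K (signedRadical B e f 1 0) + finrank K (signedRadical B e f 0 1) := by
  have hpos : ∀ x, x ∈ signedCentraliser B e 3 → f x = 0 := fun x hx =>
    hf x ⟨fun u v => (hx.1 u v).trans (by ring), hx.2⟩
  have hneg : ∀ x y : End K V, f (x * y - y * x) = 0 → f (y * x - x * y) = 0 := fun x y h => by
    rw [← neg_sub, map_neg, h, neg_zero]
  have h1 : radical e f = signedRadical B e f 1 0 ⊔ signedRadical B e f 0 1 := by
    apply le_antisymm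
    · rintro x ⟨hx, hx'⟩
      obtain ⟨a, ha, b, hb, rfl⟩ := exists_add_signedCentraliser hK hB hsymm he hx
      have hadd : ∀ y, (a + b) * y - y * (a + b) = (a * y - y * a) + (b * y - y * b) := fun y => by
        rw [add_mul, mul_add, add_sub_add_comm]
      refine Submodule.add_mem_sup ⟨ha, fun y hy => ?_⟩ ⟨hb, fun y hy => ?_⟩
      · have h2 := hx' y hy.2
        rwa [hadd, map_add, hf _ (commutator_mem_signedCentraliser hb hy), add_zero] at h2
      · have h2 := hx' y hy.2
        rwa [hadd, map_add, hpos _ (commutator_mem_signedCentraliser ha hy), zero_add] at h2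
    · refine sup_le ?_ ?_
      · rintro x ⟨hx, hx'⟩
        refine ⟨hx.2, fun y hy => ?_⟩
        obtain ⟨a, ha, b, hb, rfl⟩ := exists_add_signedCentraliser hK hB hsymm he hy
        rw [mul_add, add_mul, add_sub_add_comm, map_add, hx' b hb,
          hpos _ (commutator_mem_signedCentraliser hx ha), add_zero]
      · rintro x ⟨hx, hx'⟩
        refine ⟨hx.2, fun y hy => ?_⟩
        obtain ⟨a, ha, b, hb, rfl⟩ := exists_add_signedCentraliser hK hB hsymm he hy
        rw [mul_add, add_mul, add_sub_add_comm, map_add, hx' a ha,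
          hf _ (commutator_mem_signedCentraliser hx hb), add_zero]
  have h2 : Disjoint (signedRadical B e f 1 0) (signedRadical B e f 0 1) :=
    (disjoint_signedCentraliser hK hB).mono (fun x hx => hx.1) (fun x hx => hx.1)
  have h3 := Submodule.finrank_sup_add_finrank_inf_eq (signedRadical B e f 1 0)
    (signedRadical B e f 0 1)
  rw [h2.eq_bot, finrank_bot, add_zero] at h3
  rw [h1, h3]

lemma finrank_stabiliser_eq (α : Dual K (pCentraliser B e)) (f : Dual K (End K V))
    (hf : ∀ y : pCentraliser B e, α y = f y) :
    finrank K (stabiliser K (kCentraliser B e) α) = finrank K (signedRadical B e f 1 0) := by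
  have h1 : (stabiliser K (kCentraliser B e) α).toSubmodule.map
      (kCentraliser B e).toSubmodule.subtype = signedRadical B e f 1 0 := by
    have key : ∀ x : kCentraliser B e, x ∈ stabiliser K (kCentraliser B e) α ↔
        ∀ y ∈ signedCentraliser B e 0, f (x.1 * y - y * x.1) = 0 := by
      intro x
      change ⁅x, α⁆ = 0 ↔ _
      rw [LinearMap.ext_iff]
      simp only [Module.Dual.lie_apply, LinearMap.zero_apply, neg_eq_zero, hf]
      exact ⟨fun h y hy => h ⟨y, mem_pCentraliser_iff.2 hy⟩,
        fun h y => h y (mem_pCentraliser_iff.1 y.2)⟩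
    ext x
    constructor
    · rintro ⟨x, hx, rfl⟩
      exact ⟨mem_kCentraliser_iff.1 x.2, (key x).1 hx⟩
    · rintro ⟨hx, hx'⟩
      exact ⟨⟨x, mem_kCentraliser_iff.2 hx⟩, (key _).2 hx', rfl⟩
  rw [← h1]
  exact (Submodule.finrank_map_subtype_eq _ _).symm

/-- `𝔭_e` meets `𝔨_e` trivially, so it embeds in `End K V` modulo `𝔨_e`, where a retraction exists.
-/
lemma exists_extension (hK : (2 : K) ≠ 0) (hB : B.Nondegenerate)
    (α : Dual K (pCentraliser B e)) :
    ∃ f : Dual K (End K V), (∀ x ∈ signedCentraliser B e 1, f x = 0) ∧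
      ∀ y : pCentraliser B e, α y = f y := by
  let j : pCentraliser B e →ₗ[K] End K V ⧸ signedCentraliser B e 1 :=
    (signedCentraliser B e 1).mkQ ∘ₗ (pCentraliser B e).toSubmodule.subtype
  have hj : ker j = ⊥ := by
    rw [ker_eq_bot']
    intro y hy
    have h1 : y.1 ∈ signedCentraliser B e 1 := (Submodule.Quotient.mk_eq_zero _).1 hy
    exact Subtype.ext ((Submodule.disjoint_def.1 (disjoint_signedCentraliser hK hB)) y.1 h1
      (mem_pCentraliser_iff.1 y.2))
  obtain ⟨l, hl⟩ := j.exists_leftInverse_of_injective hj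
  refine ⟨α ∘ₗ l ∘ₗ (signedCentraliser B e 1).mkQ, fun x hx => ?_, fun y => ?_⟩
  · have h1 : (signedCentraliser B e 1).mkQ x = 0 := (Submodule.Quotient.mk_eq_zero _).2 hx
    rw [LinearMap.comp_apply, LinearMap.comp_apply, h1, map_zero, map_zero]
  · exact congrArg α (LinearMap.congr_fun hl y).symm

end Decomposition

/-! ### Dimension count in a Jordan basis. -/

section JordanBasis

open LinearMap

variable {K V : Type*} [Field K] [AddCommGroup V] [Module K V]
  {B : LinearMap.BilinForm K V} {e : End K V}

lemma skew_pow (he : ∀ u v, B (e u) v = - B u (e v)) (k : ℕ) (u v : V) :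
    B ((e ^ k) u) v = (-1) ^ k * B u ((e ^ k) v) := by
  induction k generalizing u v with
  | zero => simp
  | succ k ih =>
    rw [pow_succ, End.mul_apply, ih, he, ← End.mul_apply, ← pow_succ', pow_succ]
    ring

lemma pow_apply_pow_apply (e : End K V) (k l : ℕ) (v : V) :
    (e ^ k) ((e ^ l) v) = (e ^ (k + l)) v := by
  rw [pow_add, End.mul_apply]

lemma pow_apply_eq_zero_of_le {k l : ℕ} {v : V} (h : (e ^ k) v = 0) (hkl : k ≤ l) :
    (e ^ l) v = 0 := by
  obtain ⟨d, rfl⟩ := Nat.exists_eq_add_of_le' hkl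
  rw [← pow_apply_pow_apply, h, map_zero]

lemma commute_apply_pow {x : End K V} (h : Commute x e) (k : ℕ) (v : V) :
    x ((e ^ k) v) = (e ^ k) (x v) :=
  LinearMap.congr_fun (h.pow_right k).eq v

/-- Dimensions of the matrix blocks of a signed centraliser in a Jordan basis. -/
def blockDim {n : ℕ} (lam : Fin n → ℕ) (r : ℕ) (i j : Fin n) : ℕ :=
  if i < j then lam j else if i = j then (lam i + 1 - r) / 2 else 0

variable {n : ℕ} {lam : Fin n → ℕ} {w : Fin n → V}

/-- The numbers `B (x (w i)) (e ^ k (w j))` determine `x`. Exchanging `i` and `j` multiplies them by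
`(-1) ^ (r + k)`, so `i ≤ j` suffices, and for `i = j` only `k` of the parity of `r` can contribute.
-/
lemma finrank_signedCentraliser_le (hK : (2 : K) ≠ 0) (hB : B.Nondegenerate) (hsymm : B.IsSymm)
    (he : ∀ u v, B (e u) v = - B u (e v)) (hw : ∀ i, (e ^ lam i) (w i) = 0)
    (b : Basis (Σ i : Fin n, Fin (lam i)) K V) (hb : ∀ i s, b ⟨i, s⟩ = (e ^ (s : ℕ)) (w i))
    (r : ℕ) (hr : r < 2) :
    finrank K (signedCentraliser B e r) ≤ ∑ i, ∑ j, blockDim lam r i j := by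
  let T : End K V →ₗ[K] (∀ i j, Fin (blockDim lam r i j) → K) :=
    { toFun := fun x i j l =>
        B (x (w i)) ((e ^ (if i = j then 2 * (l : ℕ) + r else (l : ℕ))) (w j))
      map_add' := fun x y => by ext; simp
      map_smul' := fun c x => by ext; simp }
  have hT : ∀ x i j l, T x i j l =
    B (x (w i)) ((e ^ (if i = j then 2 * (l : ℕ) + r else (l : ℕ))) (w j)) := fun _ _ _ _ => rfl
  have hinj : Function.Injective (T ∘ₗ (signedCentraliser B e r).subtype) := by
    rw [← ker_eq_bot, ker_eq_bot']
    rintro ⟨x, hx, hxe⟩ hTx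
    have h0 : ∀ i j l, T x i j l = 0 := fun i j l =>
      congrFun (congrFun (congrFun hTx i) j) l
    have hswap : ∀ i j k, B (x (w j)) ((e ^ k) (w i)) =
        (-1) ^ (r + k) * B (x (w i)) ((e ^ k) (w j)) := by
      intro i j k
      rw [hx, commute_apply_pow hxe, hsymm.eq, skew_pow he]
      ring
    have hlt : ∀ i j, i < j → ∀ k, B (x (w i)) ((e ^ k) (w j)) = 0 := by
      intro i j hij k
      by_cases hk : k < lam j
      · have h1 := h0 i j ⟨k, by rwa [blockDim, if_pos hij]⟩
        rwa [hT, if_neg hij.ne] at h1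
      · rw [pow_apply_eq_zero_of_le (hw j) (not_lt.1 hk), map_zero]
    have hall : ∀ i j k, B (x (w i)) ((e ^ k) (w j)) = 0 := by
      intro i j k
      rcases lt_trichotomy i j with hij | rfl | hij
      · exact hlt i j hij k
      · by_cases hk : k < lam i
        · by_cases hpar : (r + k) % 2 = 0
          · have h1 := h0 i i ⟨(k - r) / 2, by
              rw [blockDim, if_neg (lt_irrefl i), if_pos rfl]
              omega⟩
            rw [hT, if_pos rfl] at h1
            have h2 : 2 * ((k - r) / 2) + r = k := by omega
            dsimp only at h1
            rwa [h2] at h1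
          · have h1 := hswap i i k
            rw [Odd.neg_one_pow (Nat.odd_iff.2 (by omega)), neg_one_mul] at h1
            have h2 : (2 : K) * B (x (w i)) ((e ^ k) (w i)) = 0 := by linear_combination h1
            simpa [hK] using h2
        · rw [pow_apply_eq_zero_of_le (hw i) (not_lt.1 hk), map_zero]
      · rw [hswap j i, hlt j i hij, mul_zero]
    have hxw : ∀ i, x (w i) = 0 := by
      intro i
      have h1 : B (x (w i)) = 0 := b.ext fun ⟨j, s⟩ => by
        rw [hb, hall, LinearMap.zero_apply]
      exact hB.1 _ fun v => by rw [h1, LinearMap.zero_apply]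
    have hx0 : x = 0 := b.ext fun ⟨j, s⟩ => by
      rw [hb, commute_apply_pow hxe, hxw, map_zero, LinearMap.zero_apply]
    exact Subtype.ext hx0
  refine (LinearMap.finrank_le_finrank_of_injective hinj).trans (le_of_eq ?_)
  simp [finrank_pi_fintype]

/-- The image of the `i`-th generator of the Jordan basis under the map with coefficients `c`. -/
def generatorImage (e : End K V) (lam : Fin n → ℕ) (w : Fin n → V) (i : Fin n)
    (c : ∀ j, Fin (lam (max i j)) → K) : V :=
  ∑ j, ∑ k : Fin (lam (max i j)), c j k • (e ^ ((k : ℕ) + (lam j - lam (max i j)))) (w j)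

/-- A map commuting with `e` may send each `w i` to any vector killed by `e ^ lam i`. Its component
in block `j` has `min (lam i) (lam j) = lam (max i j)` free coefficients, starting at the exponent
`lam j - lam (max i j)`. -/
lemma le_finrank_commute [FiniteDimensional K V] (hanti : Antitone lam)
    (hw : ∀ i, (e ^ lam i) (w i) = 0)
    (b : Basis (Σ i : Fin n, Fin (lam i)) K V) (hb : ∀ i s, b ⟨i, s⟩ = (e ^ (s : ℕ)) (w i))
    (S : Submodule K (End K V)) (hS : ∀ x, Commute x e → x ∈ S) :
    ∑ i, ∑ j, lam (max i j) ≤ finrank K S := by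
  let u := generatorImage e lam w
  have hmax : ∀ i j, lam (max i j) ≤ lam j := fun i j => hanti (le_max_right i j)
  have hmax' : ∀ i j, lam (max i j) ≤ lam i := fun i j => hanti (le_max_left i j)
  have hu : ∀ i c, (e ^ lam i) (u i c) = 0 := by
    intro i c
    simp only [u, generatorImage, map_sum, map_smul, pow_apply_pow_apply]
    refine Finset.sum_eq_zero fun j _ => Finset.sum_eq_zero fun k _ => ?_
    rw [pow_apply_eq_zero_of_le (hw j), smul_zero]
    have := hmax i j
    have := hmax' i j
    omega
  let T : (∀ i j, Fin (lam (max i j)) → K) →ₗ[K] End K V :=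
    (b.constr K).toLinearMap ∘ₗ
      { toFun := fun c p => (e ^ (p.2 : ℕ)) (u p.1 (c p.1))
        map_add' := fun c d => by
          ext p
          simp [u, generatorImage, add_smul, Finset.sum_add_distrib]
        map_smul' := fun a c => by
          ext p
          simp [u, generatorImage, Finset.smul_sum, mul_smul] }
  have hTb : ∀ c i s, T c (b ⟨i, s⟩) = (e ^ (s : ℕ)) (u i (c i)) := by
    intro c i s
    simp [T]
  have hTs : ∀ c i s, T c ((e ^ s) (w i)) = (e ^ s) (u i (c i)) := by
    intro c i s
    by_cases hs : s < lam i
    · rw [← hTb c i ⟨s, hs⟩, hb]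
    · rw [pow_apply_eq_zero_of_le (hw i) (not_lt.1 hs), map_zero,
        pow_apply_eq_zero_of_le (hu i (c i)) (not_lt.1 hs)]
  have hTe : ∀ c, Commute (T c) e := by
    intro c
    refine b.ext fun ⟨i, s⟩ => ?_
    rw [End.mul_apply, End.mul_apply, hTb, hb, ← End.mul_apply e, ← pow_succ', hTs, pow_succ',
      End.mul_apply]
  have hTinj : Function.Injective T := by
    rw [← ker_eq_bot, ker_eq_bot']
    intro c hc
    ext i j k
    have h1 : u i (c i) = 0 := by
      have := hTs c i 0
      rw [hc, LinearMap.zero_apply, pow_zero, End.one_apply] at this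
      exact this.symm
    let ψ : (Σ j, Fin (lam (max i j))) → Σ j : Fin n, Fin (lam j) := fun q =>
      ⟨q.1, ⟨(q.2 : ℕ) + (lam q.1 - lam (max i q.1)), by
        have := hmax i q.1
        have := q.2.2
        omega⟩⟩
    have hψ : Function.Injective ψ := by
      rintro ⟨j, k⟩ ⟨j', k'⟩ h
      obtain rfl : j = j' := congrArg Sigma.fst h
      have h2 := eq_of_heq (Sigma.mk.inj h).2
      simp only [Fin.mk.injEq, add_left_inj] at h2
      rw [Fin.ext h2]
    have hli := Fintype.linearIndependent_iff.1 (b.linearIndependent.comp ψ hψ)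
    refine hli (fun q => c i q.1 q.2) ?_ ⟨j, k⟩
    rw [Fintype.sum_sigma, ← h1]
    refine Finset.sum_congr rfl fun j _ => Finset.sum_congr rfl fun k _ => ?_
    rw [Function.comp_apply, hb]
  have hfin := LinearMap.finrank_le_finrank_of_injective
    (f := T.codRestrict S fun c => hS _ (hTe c))
    (fun c d h => hTinj (congrArg Subtype.val h))
  refine le_trans (le_of_eq ?_) hfin
  simp [finrank_pi_fintype]

lemma sum_eq_sum_add_of_eq_add_ite {i : Fin n} {f g : Fin n → ℕ} {a : ℕ}
    (h : ∀ j, f j = g j + if i = j then a else 0) : ∑ j, f j = ∑ j, g j + a := by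
  simp [h, Finset.sum_add_distrib]

lemma sum_max_eq_sum_blockDim (lam : Fin n → ℕ) :
    ∑ i, ∑ j, lam (max i j) = ∑ i, ∑ j, blockDim lam 0 i j + ∑ i, ∑ j, blockDim lam 1 i j := by
  have h1 : ∀ r, ∑ i, ∑ j, blockDim lam r i j =
      ∑ i, ∑ j, (if i < j then lam j else 0) + ∑ i, (lam i + 1 - r) / 2 := by
    intro r
    rw [← Finset.sum_add_distrib]
    refine Finset.sum_congr rfl fun i _ => ?_
    refine sum_eq_sum_add_of_eq_add_ite (i := i) fun j => ?_
    unfold blockDim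
    split_ifs with h h' <;> first | rfl | (exfalso; omega) | simp
  have h2 : ∑ i, ∑ j, lam (max i j) = ∑ i, ∑ j, (if i < j then lam j else 0) +
      ∑ i, ∑ j, (if j < i then lam i else 0) + ∑ i, lam i := by
    rw [← Finset.sum_add_distrib, ← Finset.sum_add_distrib]
    refine Finset.sum_congr rfl fun i _ => ?_
    rw [← Finset.sum_add_distrib]
    refine sum_eq_sum_add_of_eq_add_ite (i := i) fun j => ?_
    rcases lt_trichotomy i j with h | rfl | h
    · simp [h, h.le, h.not_gt, h.ne]
    · simp
    · simp [h, h.le, h.ne']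
  have h3 : ∑ i, lam i = ∑ i, (lam i + 1 - 0) / 2 + ∑ i, (lam i + 1 - 1) / 2 := by
    rw [← Finset.sum_add_distrib]
    exact Finset.sum_congr rfl fun i _ => by omega
  have h4 : ∑ i, ∑ j, (if j < i then lam i else 0) = ∑ i, ∑ j, (if i < j then lam j else 0) :=
    Finset.sum_comm
  rw [h1, h1, h2, h3, h4]
  omega

lemma sum_blockDim_zero_eq (lam : Fin n → ℕ) : ∑ i, ∑ j, blockDim lam 0 i j =
    ∑ i, ∑ j, blockDim lam 1 i j + Fintype.card {i : Fin n // Odd (lam i)} := by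
  rw [Fintype.card_subtype, Finset.card_filter, ← Finset.sum_add_distrib]
  refine Finset.sum_congr rfl fun i _ => ?_
  refine sum_eq_sum_add_of_eq_add_ite (i := i) fun j => ?_
  unfold blockDim
  simp only [Nat.odd_iff]
  split_ifs <;> omega

/-- The dimensions of `𝔨_e` and `𝔭_e` differ by the number of odd Jordan blocks. -/
lemma finrank_signedCentraliser_zero [FiniteDimensional K V] (hK : (2 : K) ≠ 0)
    (hB : B.Nondegenerate) (hsymm : B.IsSymm) (he : ∀ u v, B (e u) v = - B u (e v))
    (hlam : HasJordanPartition e lam) :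
    finrank K (signedCentraliser B e 0) =
      finrank K (signedCentraliser B e 1) + Fintype.card {i : Fin n // Odd (lam i)} := by
  obtain ⟨hanti, -, w, hw, b, hb⟩ := hlam
  have h0 := finrank_signedCentraliser_le hK hB hsymm he hw b hb 0 (by norm_num)
  have h1 := finrank_signedCentraliser_le hK hB hsymm he hw b hb 1 (by norm_num)
  -- The upper bounds for the two summands add up to this lower bound for their sum, so both are
  -- equalities.
  have h2 := le_finrank_commute hanti hw b hb
    (signedCentraliser B e 1 ⊔ signedCentraliser B e 0) (fun x hx => by
      obtain ⟨a, ha, c, hc, rfl⟩ := exists_add_signedCentraliser hK hB hsymm he hx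
      exact Submodule.add_mem_sup ha hc)
  have h3 := Submodule.finrank_add_le_finrank_add_finrank (signedCentraliser B e 1)
    (signedCentraliser B e 0)
  have h4 := sum_max_eq_sum_blockDim lam
  have h5 := sum_blockDim_zero_eq lam
  omega

end JordanBasis

/-! ### A functional with small radical, from dual families of Jordan generators. -/

section DualFamily

open LinearMap

variable {K V : Type*} [Field K] [AddCommGroup V] [Module K V]
  {B : LinearMap.BilinForm K V} {e : End K V}

/-- The span of the `e`-orbits of a family of vectors. -/
def cyclicSpan (e : End K V) {ι : Type} (w : ι → V) : Submodule K V :=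
  Submodule.span K (Set.range fun p : ι × ℕ => (e ^ p.2) (w p.1))

lemma pow_mem_cyclicSpan {ι : Type} (w : ι → V) (i : ι) (s : ℕ) :
    (e ^ s) (w i) ∈ cyclicSpan e w :=
  Submodule.subset_span ⟨(i, s), rfl⟩

lemma mem_cyclicSpan {ι : Type} (w : ι → V) (i : ι) : w i ∈ cyclicSpan e w :=
  pow_mem_cyclicSpan w i 0

lemma cyclicSpan_le {ι : Type} {w : ι → V} {W : Submodule K V} :
    cyclicSpan e w ≤ W ↔ ∀ i s, (e ^ s) (w i) ∈ W := by
  rw [cyclicSpan, Submodule.span_le, Set.range_subset_iff]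
  exact Prod.forall

lemma apply_mem_cyclicSpan {ι : Type} (w : ι → V) {x : V} (hx : x ∈ cyclicSpan e w) :
    e x ∈ cyclicSpan e w := by
  suffices h : cyclicSpan e w ≤ (cyclicSpan e w).comap e from h hx
  rw [cyclicSpan_le]
  intro i s
  rw [Submodule.mem_comap, ← End.mul_apply, ← pow_succ']
  exact pow_mem_cyclicSpan w i _

lemma pow_apply_mem {W : Submodule K V} (hW : ∀ x ∈ W, e x ∈ W) (s : ℕ) {x : V} (hx : x ∈ W) :
    (e ^ s) x ∈ W := by
  induction s with
  | zero => simpa using hx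
  | succ s ih =>
    rw [pow_succ', End.mul_apply]
    exact hW _ ih

/-- Generators `w i` of Jordan blocks of `e` of sizes `μ i`, spanning `W`, with a dual family of
generators `v i` for which `x ↦ ∑ i, B (v i) (x (w i))` vanishes on skew maps. -/
structure IsDualFamily (B : LinearMap.BilinForm K V) (e : End K V) (W : Submodule K V)
    {ι : Type} [Fintype ι] (w v : ι → V) (μ : ι → ℕ) : Prop where
  pow_left : ∀ i, (e ^ μ i) (w i) = 0
  pow_right : ∀ i, (e ^ μ i) (v i) = 0
  ortho : ∀ i j, i ≠ j → ∀ s, B (v i) ((e ^ s) (w j)) = 0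
  top_ne : ∀ i, B (v i) ((e ^ (μ i - 1)) (w i)) ≠ 0
  skew : ∀ x : End K V, (∀ y z, B (x y) z = - B y (x z)) → ∑ i, B (v i) (x (w i)) = 0
  span_left : cyclicSpan e w = W
  span_right : cyclicSpan e v = W

/-- The map commuting with `e` attached to the pair `(w p, v q)` and a shift `r`. -/
def testMap (B : LinearMap.BilinForm K V) (e : End K V) {ι : Type} (w v : ι → V) (p q : ι) (M r : ℕ) :
    End K V :=
  ∑ a ∈ Finset.range (M + 1), ((B (v q)) ∘ₗ (e ^ (M - a + r))).smulRight ((e ^ a) (w p))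

lemma testMap_apply {ι : Type} {w v : ι → V} (p q : ι) (M r : ℕ) (z : V) : testMap B e w v p q M r z =
    ∑ a ∈ Finset.range (M + 1), B (v q) ((e ^ (M - a + r)) z) • (e ^ a) (w p) := by
  simp [testMap, LinearMap.sum_apply]

/-- Applying `e` before or after the map gives the same sum up to an index shift; the two boundary
terms vanish by `hp` and `hq`. -/
lemma commute_testMap {ι : Type} {w v : ι → V} {p q : ι} {M : ℕ} (hp : (e ^ (M + 1)) (w p) = 0)
    (hq : ∀ z, B (v q) ((e ^ (M + 1)) z) = 0) (r : ℕ) : Commute (testMap B e w v p q M r) e := by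
  ext z
  rw [End.mul_apply, End.mul_apply, testMap_apply, testMap_apply, map_sum]
  let h : ℕ → V := fun a => B (v q) ((e ^ (M + 1 - a + r)) z) • (e ^ a) (w p)
  have h1 : ∀ a ∈ Finset.range (M + 1),
      B (v q) ((e ^ (M - a + r)) (e z)) • (e ^ a) (w p) = h a := by
    intro a ha
    rw [Finset.mem_range] at ha
    have : M + 1 - a + r = M - a + r + 1 := by omega
    simp only [h, this, pow_succ, End.mul_apply]
  have h2 : ∀ a ∈ Finset.range (M + 1),
      e (B (v q) ((e ^ (M - a + r)) z) • (e ^ a) (w p)) = h (a + 1) := by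
    intro a _
    have : M + 1 - (a + 1) + r = M - a + r := by omega
    simp only [h, this, pow_succ', End.mul_apply, map_smul]
  rw [Finset.sum_congr rfl h1, Finset.sum_congr rfl h2]
  have h3 := Finset.sum_range_succ h (M + 1)
  rw [Finset.sum_range_succ'] at h3
  have h4 : h 0 = 0 := by
    simp only [h, Nat.sub_zero, ← pow_apply_pow_apply e (M + 1), hq, zero_smul]
  have h5 : h (M + 1) = 0 := by
    simp only [h, hp, smul_zero]
  rw [h4, h5, add_zero, add_zero] at h3
  exact h3.symm

namespace IsDualFamily

variable {W : Submodule K V} {ι : Type} [Fintype ι] {w v : ι → V} {μ : ι → ℕ}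

/-- Orthogonality isolates block `q`, where the pairing of the `e`-orbits of `v q` and `w q` is
triangular with the nonzero invariant `top_ne` on its antidiagonal. -/
lemma coeff_eq_zero (h : IsDualFamily B e W w v μ) (c : (Σ i, Fin (μ i)) → K)
    (hc : ∀ q r, B (v q) ((e ^ r) (∑ t, c t • (e ^ (t.2 : ℕ)) (w t.1))) = 0) : ∀ t, c t = 0 := by
  have key : ∀ q (r : ℕ), ∑ s : Fin (μ q),
      c ⟨q, s⟩ * B (v q) ((e ^ (r + (s : ℕ))) (w q)) = 0 := by
    intro q r
    rw [← hc q r, Fintype.sum_sigma, map_sum, map_sum,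
      Finset.sum_eq_single q _ (fun hq => absurd (Finset.mem_univ q) hq)]
    · simp only [map_sum, map_smul, smul_eq_mul, pow_apply_pow_apply]
    · intro p _ hp
      simp only [map_sum, map_smul, smul_eq_mul, pow_apply_pow_apply]
      exact Finset.sum_eq_zero fun s _ => by rw [h.ortho q p hp.symm, mul_zero]
  have main : ∀ q k, ∀ hk : k < μ q, c ⟨q, ⟨k, hk⟩⟩ = 0 := by
    intro q k
    induction k using Nat.strong_induction_on with
    | _ k ih =>
      intro hk
      have h1 := key q (μ q - 1 - k)
      rw [Finset.sum_eq_single ⟨k, hk⟩ _ (fun hq => absurd (Finset.mem_univ _) hq)] at h1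
      · have h2 : μ q - 1 - k + k = μ q - 1 := by omega
        dsimp only at h1
        rw [h2] at h1
        exact (mul_eq_zero.1 h1).resolve_right (h.top_ne q)
      · rintro ⟨s, hs⟩ _ hne
        have hne' : s ≠ k := fun hsk => hne (Fin.ext hsk)
        rcases lt_or_gt_of_ne hne' with hlt | hgt
        · rw [ih s hlt hs, zero_mul]
        · rw [pow_apply_eq_zero_of_le (h.pow_left q) (by dsimp only; omega), map_zero, mul_zero]
  rintro ⟨q, k, hk⟩
  exact main q k hk

lemma eq_zero_of_mem (h : IsDualFamily B e W w v μ) {z : V} (hz : z ∈ W)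
    (hz' : ∀ q r, B (v q) ((e ^ r) z) = 0) : z = 0 := by
  have h1 : z ∈ Submodule.span K
      (Set.range fun t : Σ i, Fin (μ i) => (e ^ (t.2 : ℕ)) (w t.1)) := by
    rw [← h.span_left] at hz
    refine cyclicSpan_le.2 (fun i s => ?_) hz
    by_cases hs : s < μ i
    · exact Submodule.subset_span ⟨⟨i, ⟨s, hs⟩⟩, rfl⟩
    · rw [pow_apply_eq_zero_of_le (h.pow_left i) (not_lt.1 hs)]
      exact zero_mem _
  obtain ⟨c, rfl⟩ := (Submodule.mem_span_range_iff_exists_fun K).1 h1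
  have hc := h.coeff_eq_zero c hz'
  exact Finset.sum_eq_zero fun t _ => by rw [hc, zero_smul]

lemma sum_le_finrank [FiniteDimensional K V] (h : IsDualFamily B e W w v μ) :
    ∑ i, μ i ≤ finrank K V := by
  have hli : LinearIndependent K
      (fun t : Σ i, Fin (μ i) => (e ^ (t.2 : ℕ)) (w t.1)) := by
    rw [Fintype.linearIndependent_iff]
    intro c hc
    exact h.coeff_eq_zero c fun q r => by rw [hc, map_zero, map_zero]
  simpa using hli.fintype_card_le_finrank

lemma eq_zero_of_orthogonal (h : IsDualFamily B e W w v μ)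
    (he : ∀ u v, B (e u) v = - B u (e v)) {z : V} (hz : z ∈ W) (hz' : ∀ y ∈ W, B y z = 0) :
    z = 0 := by
  refine h.eq_zero_of_mem hz fun q r => ?_
  have h1 := hz' ((e ^ r) (v q)) (by rw [← h.span_right]; exact pow_mem_cyclicSpan v q r)
  rw [skew_pow he] at h1
  exact (mul_eq_zero.1 h1).resolve_left (pow_ne_zero _ (neg_ne_zero.2 one_ne_zero))

/-- The functional attached to a dual family. -/
def functional (B : LinearMap.BilinForm K V) (w v : ι → V) : Dual K (End K V) :=
  ∑ i, (B (v i)) ∘ₗ (LinearMap.applyₗ (w i))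

lemma functional_apply (x : End K V) : functional B w v x = ∑ i, B (v i) (x (w i)) := by
  simp [functional, LinearMap.sum_apply]

lemma functional_mul_testMap (h : IsDualFamily B e W w v μ) {x : End K V} (hx : Commute x e)
    (p q : ι) (M r : ℕ) : functional B w v (x * testMap B e w v p q M r) =
      ∑ a ∈ Finset.range (M + 1),
        B (v q) ((e ^ (M - a + r)) (w q)) * B (v q) ((e ^ a) (x (w p))) := by
  rw [functional_apply, Finset.sum_eq_single q _ (fun hq => absurd (Finset.mem_univ q) hq)]
  · simp only [End.mul_apply, testMap_apply, map_sum, map_smul, smul_eq_mul, commute_apply_pow hx]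
  · intro i _ hi
    rw [End.mul_apply, testMap_apply]
    simp only [h.ortho q i hi.symm, zero_smul, Finset.sum_const_zero, map_zero]

lemma functional_testMap_mul (h : IsDualFamily B e W w v μ) (x : End K V)
    (p q : ι) (M r : ℕ) : functional B w v (testMap B e w v p q M r * x) =
      ∑ a ∈ Finset.range (M + 1),
        B (v q) ((e ^ (M - a + r)) (x (w p))) * B (v p) ((e ^ a) (w p)) := by
  rw [functional_apply, Finset.sum_eq_single p _ (fun hq => absurd (Finset.mem_univ p) hq)]
  · simp only [End.mul_apply, testMap_apply, map_sum, map_smul, smul_eq_mul]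
  · intro i _ hi
    rw [End.mul_apply, testMap_apply]
    simp only [map_sum, map_smul, h.ortho i p hi, smul_zero, Finset.sum_const_zero]

/-- The off-diagonal blocks of elements of the radical vanish. -/
lemma block_eq_zero (h : IsDualFamily B e W w v μ) (he : ∀ u v, B (e u) v = - B u (e v))
    (hinj : Function.Injective fun i => B (v i) ((e ^ (μ i - 1)) (w i))) {x : End K V}
    (hx : x ∈ radical e (functional B w v)) {p q : ι} (hpq : p ≠ q) (s : ℕ) :
    B (v q) ((e ^ s) (x (w p))) = 0 := by
  have hv : ∀ i k, μ i ≤ k → ∀ z, B (v i) ((e ^ k) z) = 0 := by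
    intro i k hk z
    have h1 := skew_pow he k (v i) z
    rw [pow_apply_eq_zero_of_le (h.pow_right i) hk, map_zero, LinearMap.zero_apply] at h1
    exact (mul_eq_zero.1 h1.symm).resolve_left (pow_ne_zero _ (neg_ne_zero.2 one_ne_zero))
  have hμ : ∀ i, 0 < μ i := by
    intro i
    by_contra h0
    exact h.top_ne i (hv i _ (by omega) _)
  have hp : ∀ k, μ p ≤ k → B (v q) ((e ^ k) (x (w p))) = 0 := by
    intro k hk
    rw [← commute_apply_pow hx.1, pow_apply_eq_zero_of_le (h.pow_left p) hk, map_zero, map_zero]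
  -- Descending induction on `s`, starting where `e ^ s` kills `x (w p)`.
  suffices main : ∀ d s, μ p ≤ s + d → B (v q) ((e ^ s) (x (w p))) = 0 from
    main (μ p) s (by omega)
  intro d
  induction d with
  | zero => exact fun s hs => hp s hs
  | succ d ih =>
    intro s hs
    by_cases hsp : μ p ≤ s
    · exact hp s hsp
    by_cases hsq : μ q ≤ s
    · exact hv q s hsq _
    obtain ⟨M, hM⟩ : ∃ M, max (μ p) (μ q) = M + 1 :=
      ⟨max (μ p) (μ q) - 1, by have := hμ p; omega⟩
    have hMp : μ p ≤ M + 1 := hM ▸ le_max_left _ _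
    have hMq : μ q ≤ M + 1 := hM ▸ le_max_right _ _
    -- Each of `f (x y)` and `f (y x)` collapses to one term: the coefficient sought times `B (v q)
    -- (e ^ M (w q))`, respectively `B (v p) (e ^ M (w p))`. As `M + 1 = max (μ p) (μ q)`, these
    -- factors differ: one is zero and the other not if the sizes differ, and otherwise they are
    -- distinct invariants.
    have h1 := hx.2 (testMap B e w v p q M s)
      (commute_testMap (pow_apply_eq_zero_of_le (h.pow_left p) hMp) (hv q _ hMq) s)
    rw [map_sub, h.functional_mul_testMap hx.1, h.functional_testMap_mul, sub_eq_zero,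
      Finset.sum_eq_single s, Finset.sum_eq_single M] at h1
    · have h2 : M - s + s = M := by omega
      rw [h2, Nat.sub_self, zero_add, mul_comm, ← sub_eq_zero, ← mul_sub] at h1
      refine (mul_eq_zero.1 h1).resolve_right (sub_ne_zero.2 ?_)
      rcases lt_trichotomy (μ p) (μ q) with hlt | heq | hgt
      · have h3 : M = μ q - 1 := by omega
        rw [hv p M (by omega), h3]
        exact h.top_ne q
      · have h3 : M = μ q - 1 := by omega
        have h4 : M = μ p - 1 := by omega
        intro h5
        refine hpq (hinj ?_)
        dsimp only
        rw [← h3, ← h4, h5]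
      · have h3 : M = μ p - 1 := by omega
        rw [hv q M (by omega), h3]
        exact (h.top_ne p).symm
    · intro a ha hne
      rw [Finset.mem_range] at ha
      rw [ih (M - a + s) (by omega), zero_mul]
    · intro hM'
      exact absurd (Finset.self_mem_range_succ M) hM'
    · intro a ha hne
      rw [Finset.mem_range] at ha
      rcases lt_or_gt_of_ne hne with hlt | hgt
      · rw [hv q _ (by omega), zero_mul]
      · rw [ih a (by omega), mul_zero]
    · intro hs'
      exact absurd (Finset.mem_range.2 (by omega)) hs'

/-- Only the diagonal blocks survive, and block `i` of a map commuting with `e` has `μ i`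
coefficients. -/
lemma finrank_radical_le [FiniteDimensional K V] (h : IsDualFamily B e ⊤ w v μ)
    (he : ∀ u v, B (e u) v = - B u (e v))
    (hinj : Function.Injective fun i => B (v i) ((e ^ (μ i - 1)) (w i))) :
    finrank K (radical e (functional B w v)) ≤ finrank K V := by
  let T : End K V →ₗ[K] (∀ i, Fin (μ i) → K) :=
    { toFun := fun x i s => B (v i) ((e ^ (s : ℕ)) (x (w i)))
      map_add' := fun x y => by ext; simp
      map_smul' := fun c x => by ext; simp }
  have hT : Function.Injective (T ∘ₗ (radical e (functional B w v)).subtype) := by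
    rw [← ker_eq_bot, ker_eq_bot']
    rintro ⟨x, hx⟩ hTx
    have hxw : ∀ p, x (w p) = 0 := by
      intro p
      refine h.eq_zero_of_mem Submodule.mem_top fun q r => ?_
      by_cases hpq : p = q
      · subst hpq
        by_cases hr : r < μ p
        · exact congrFun (congrFun hTx p) ⟨r, hr⟩
        · rw [← commute_apply_pow hx.1, pow_apply_eq_zero_of_le (h.pow_left p) (not_lt.1 hr),
            map_zero, map_zero]
      · exact h.block_eq_zero he hinj hx hpq r
    have hker : cyclicSpan e w ≤ ker x := cyclicSpan_le.2 fun i s => by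
      rw [mem_ker, commute_apply_pow hx.1, hxw, map_zero]
    rw [h.span_left, top_le_iff, ker_eq_top] at hker
    exact Subtype.ext hker
  refine (LinearMap.finrank_le_finrank_of_injective hT).trans (le_trans (le_of_eq ?_)
    h.sum_le_finrank)
  simp [finrank_pi_fintype]

lemma sup (hsymm : B.IsSymm) {W' : Submodule K V} {κ : Type} [Fintype κ] {w' v' : κ → V}
    {ν : κ → ℕ} (h : IsDualFamily B e W w v μ) (h' : IsDualFamily B e W' w' v' ν)
    (hWW' : ∀ x ∈ W, ∀ y ∈ W', B x y = 0) :
    IsDualFamily B e (W ⊔ W') (Sum.elim w w') (Sum.elim v v') (Sum.elim μ ν) := by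
  have hspan : ∀ (a : ι → V) (b : κ → V),
      cyclicSpan e (Sum.elim a b) = cyclicSpan e a ⊔ cyclicSpan e b := by
    intro a b
    apply le_antisymm
    · rw [cyclicSpan_le]
      rintro (i | i) s
      · exact Submodule.mem_sup_left (pow_mem_cyclicSpan a i s)
      · exact Submodule.mem_sup_right (pow_mem_cyclicSpan b i s)
    · rw [sup_le_iff, cyclicSpan_le, cyclicSpan_le]
      exact ⟨fun i s => pow_mem_cyclicSpan (Sum.elim a b) (Sum.inl i) s,
        fun i s => pow_mem_cyclicSpan (Sum.elim a b) (Sum.inr i) s⟩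
  refine ⟨?_, ?_, ?_, ?_, ?_, ?_, ?_⟩
  · rintro (i | i)
    exacts [h.pow_left i, h'.pow_left i]
  · rintro (i | i)
    exacts [h.pow_right i, h'.pow_right i]
  · rintro (i | i) (j | j) hij s
    · exact h.ortho i j (fun hh => hij (congrArg _ hh)) s
    · refine hWW' _ ?_ _ ?_
      · rw [← h.span_right]; exact mem_cyclicSpan v i
      · rw [← h'.span_left]; exact pow_mem_cyclicSpan w' j s
    · rw [hsymm.eq]
      refine hWW' _ ?_ _ ?_
      · rw [← h.span_left]; exact pow_mem_cyclicSpan w j s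
      · rw [← h'.span_right]; exact mem_cyclicSpan v' i
    · exact h'.ortho i j (fun hh => hij (congrArg _ hh)) s
  · rintro (i | i)
    exacts [h.top_ne i, h'.top_ne i]
  · intro x hx
    rw [Fintype.sum_sum_type]
    simp only [Sum.elim_inl, Sum.elim_inr]
    rw [h.skew x hx, h'.skew x hx, add_zero]
  · rw [hspan, h.span_left, h'.span_left]
  · rw [hspan, h.span_right, h'.span_right]

end IsDualFamily

/-! ### Existence of dual families. -/

/-- `W` has dual families whose invariants are distinct and avoid a given finite set. -/
def HasDualFamilies (B : LinearMap.BilinForm K V) (e : End K V) (W : Submodule K V) : Prop :=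
  ∀ F : Finset K, ∃ (ι : Type) (_ : Fintype ι) (w v : ι → V) (μ : ι → ℕ),
    IsDualFamily B e W w v μ ∧
      (Function.Injective fun i => B (v i) ((e ^ (μ i - 1)) (w i))) ∧
      ∀ i, B (v i) ((e ^ (μ i - 1)) (w i)) ∉ F

lemma hasDualFamilies_bot : HasDualFamilies B e ⊥ := by
  intro F
  refine ⟨Empty, inferInstance, Empty.elim, Empty.elim, Empty.elim,
    ⟨nofun, nofun, nofun, nofun, fun x _ => by simp, ?_, ?_⟩, nofun, nofun⟩
  all_goals
    rw [eq_bot_iff, cyclicSpan_le]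
    exact nofun

/-- The second family is chosen to avoid the invariants of the first as well as `F`, so the union
keeps distinct invariants. -/
lemma HasDualFamilies.sup (hsymm : B.IsSymm) {W W' : Submodule K V}
    (h : HasDualFamilies B e W) (h' : HasDualFamilies B e W')
    (hWW' : ∀ x ∈ W, ∀ y ∈ W', B x y = 0) : HasDualFamilies B e (W ⊔ W') := by
  classical
  intro F
  obtain ⟨ι, _, w, v, μ, hw, hinj, hF⟩ := h F
  obtain ⟨κ, _, w', v', ν, hw', hinj', hF'⟩ :=
    h' (F ∪ Finset.univ.image fun i => B (v i) ((e ^ (μ i - 1)) (w i)))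
  have hne : ∀ i j, B (v i) ((e ^ (μ i - 1)) (w i)) ≠ B (v' j) ((e ^ (ν j - 1)) (w' j)) := by
    intro i j hij
    refine hF' j (Finset.mem_union_right _ ?_)
    rw [← hij]
    exact Finset.mem_image_of_mem _ (Finset.mem_univ i)
  refine ⟨ι ⊕ κ, inferInstance, _, _, _, hw.sup hsymm hw' hWW', ?_, ?_⟩
  · rintro (i | i) (j | j) hij
    · exact congrArg _ (hinj hij)
    · exact absurd hij (hne i j)
    · exact absurd hij.symm (hne j i)
    · exact congrArg _ (hinj' hij)
  · rintro (i | i)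
    · exact hF i
    · exact fun hi => hF' i (Finset.mem_union_left _ hi)

/-- Take `v i = a • w (σ i)`. For skew `x`, reindexing by `σ` changes the sign of `∑ B (w (σ i)) (x
(w i))`, which therefore vanishes; the scalar `a` moves the invariants off `F`. -/
lemma hasDualFamilies_of_involutive [Infinite K] (hK : (2 : K) ≠ 0) (hsymm : B.IsSymm)
    {ι : Type} [Fintype ι] {σ : ι → ι}
    (hσ : Function.Involutive σ) (w : ι → V) (m : ℕ) (hw : ∀ i, (e ^ (m + 1)) (w i) = 0)
    (hortho : ∀ i j, i ≠ j → ∀ s, B (w (σ i)) ((e ^ s) (w j)) = 0)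
    (hne : ∀ i, B (w (σ i)) ((e ^ m) (w i)) ≠ 0)
    (hinj : Function.Injective fun i => B (w (σ i)) ((e ^ m) (w i))) :
    HasDualFamilies B e (cyclicSpan e w) := by
  classical
  intro F
  obtain ⟨a, ha⟩ := Infinite.exists_notMem_finset
    (insert 0 ((F ×ˢ (Finset.univ : Finset ι)).image
      fun t => t.1 / B (w (σ t.2)) ((e ^ m) (w t.2))))
  rw [Finset.mem_insert, not_or] at ha
  obtain ⟨ha0, haF⟩ := ha
  refine ⟨ι, inferInstance, w, fun i => a • w (σ i), fun _ => m + 1,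
    ⟨hw, fun i => ?_, fun i j hij s => ?_, fun i => ?_, fun x hx => ?_, rfl, ?_⟩,
    fun i j hij => ?_, fun i hi => ?_⟩
  · rw [map_smul, hw, smul_zero]
  · rw [map_smul, LinearMap.smul_apply, hortho i j hij, smul_zero]
  · rw [map_smul, LinearMap.smul_apply]
    exact smul_ne_zero ha0 (hne i)
  · simp only [map_smul, LinearMap.smul_apply]
    rw [← Finset.smul_sum]
    have h1 : ∑ i, B (w (σ i)) (x (w i)) = - ∑ i, B (w (σ i)) (x (w i)) := by
      rw [← Finset.sum_neg_distrib]
      refine Fintype.sum_equiv hσ.toPerm _ _ fun i => ?_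
      rw [Function.Involutive.coe_toPerm, hσ, hsymm.eq, hx]
    have h2 : (2 : K) * ∑ i, B (w (σ i)) (x (w i)) = 0 := by linear_combination h1
    rw [(mul_eq_zero.1 h2).resolve_left hK, smul_zero]
  · apply le_antisymm
    · rw [cyclicSpan_le]
      intro i s
      rw [map_smul]
      exact Submodule.smul_mem _ _ (pow_mem_cyclicSpan w _ s)
    · rw [cyclicSpan_le]
      intro i s
      have h1 := Submodule.smul_mem _ a⁻¹
        (pow_mem_cyclicSpan (e := e) (K := K) (fun i => a • w (σ i)) (σ i) s)
      rwa [hσ, map_smul, smul_smul, inv_mul_cancel₀ ha0, one_smul] at h1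
  · simp only [map_smul, LinearMap.smul_apply, smul_eq_mul] at hij
    exact hinj (mul_left_cancel₀ ha0 hij)
  · refine haF (Finset.mem_image.2 ⟨(_, i), Finset.mem_product.2 ⟨hi, Finset.mem_univ i⟩, ?_⟩)
    simp only [map_smul, LinearMap.smul_apply, smul_eq_mul, Nat.add_sub_cancel]
    exact mul_div_cancel_right₀ _ (hne i)

/-- For odd `m`, one of two paired generators can be made isotropic along its `e`-orbit. -/
lemma exists_isotropic (hK : (2 : K) ≠ 0) (hsymm : B.IsSymm)
    (he : ∀ u v, B (e u) v = - B u (e v)) {W : Submodule K V} (hW : ∀ x ∈ W, e x ∈ W)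
    {m : ℕ} (hm : Odd m) (hWm : ∀ x ∈ W, (e ^ (m + 1)) x = 0) {w w' : V} (hw : w ∈ W)
    (hw' : w' ∈ W) (hne : B w' ((e ^ m) w) ≠ 0) :
    ∃ u ∈ W, B w' ((e ^ m) u) ≠ 0 ∧ ∀ s, B u ((e ^ s) u) = 0 := by
  have hzero : ∀ x ∈ W, ∀ k, m < k → (e ^ k) x = 0 := fun x hx k hk =>
    pow_apply_eq_zero_of_le (hWm x hx) hk
  suffices main : ∀ d, ∃ u ∈ W, B w' ((e ^ m) u) ≠ 0 ∧ ∀ s, m < s + d → B u ((e ^ s) u) = 0 by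
    obtain ⟨u, hu, h1, h2⟩ := main (m + 1)
    exact ⟨u, hu, h1, fun s => h2 s (by omega)⟩
  intro d
  induction d with
  | zero => exact ⟨w, hw, hne, fun s hs => by rw [hzero w hw s (by omega), map_zero]⟩
  | succ d ih =>
    obtain ⟨u, hu, h1, h2⟩ := ih
    by_cases hdm : m < d
    · exact ⟨u, hu, h1, fun s _ => h2 s (by omega)⟩
    -- The new exponent is `s = m - d`. If `d` is even then `s` is odd and `B u (e ^ s u)` vanishes
    -- by skewness.
    rcases Nat.even_or_odd d with hd | hd
    · refine ⟨u, hu, h1, fun s hs => ?_⟩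
      by_cases hs' : m < s + d
      · exact h2 s hs'
      have hsodd : Odd s := by
        have h3 : s + d = m := by omega
        rw [← h3] at hm
        exact (Nat.odd_add.1 hm).2 hd
      have h3 := skew_pow he s u u
      rw [hsymm.eq, hsodd.neg_one_pow] at h3
      have h4 : (2 : K) * B u ((e ^ s) u) = 0 := by linear_combination h3
      exact (mul_eq_zero.1 h4).resolve_left hK
    · set β := B w' ((e ^ m) u) with hβ
      -- Adding `q • e ^ d w'` changes `B u (e ^ (m - d) u)` by `-2 q β`, the quadratic term being
      -- zero since `e ^ (m + 1)` kills `w'`.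
      let q : K := B u ((e ^ (m - d)) u) / (2 * β)
      have hdpos : 0 < d := hd.pos
      refine ⟨u + q • (e ^ d) w', W.add_mem hu (W.smul_mem _ (pow_apply_mem hW d hw')), ?_, ?_⟩
      · rw [map_add, map_add, map_smul, pow_apply_pow_apply, hzero w' hw' (m + d) (by omega),
          smul_zero, map_zero, add_zero]
        exact h1
      · intro s hs
        have hA : B u ((e ^ (s + d)) w') = (-1) ^ (s + d) * B w' ((e ^ (s + d)) u) := by
          rw [hsymm.eq, skew_pow he]
        have hC : B ((e ^ d) w') ((e ^ s) u) = - B w' ((e ^ (s + d)) u) := by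
          rw [skew_pow he, hd.neg_one_pow, pow_apply_pow_apply, add_comm d s, neg_one_mul]
        have hD : B ((e ^ d) w') ((e ^ (s + d)) w') = 0 := by
          rw [skew_pow he, pow_apply_pow_apply, hzero w' hw' _ (by omega), map_zero, mul_zero]
        have hexp : B (u + q • (e ^ d) w') ((e ^ s) (u + q • (e ^ d) w')) =
            B u ((e ^ s) u) + q * ((-1) ^ (s + d) - 1) * B w' ((e ^ (s + d)) u) := by
          simp only [map_add, map_smul, LinearMap.add_apply, LinearMap.smul_apply, smul_eq_mul,
            pow_apply_pow_apply, hA, hC, hD]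
          ring
        rw [hexp]
        by_cases hs' : m < s + d
        · rw [h2 s hs', hzero u hu _ hs', map_zero, mul_zero, add_zero]
        · have h3 : s + d = m := by omega
          have h4 : m - d = s := by omega
          rw [h3, hm.neg_one_pow, ← hβ]
          simp only [q, h4]
          field_simp
          ring

/-- Let `m + 1` be the nilpotency order of `e` on `W`. The nonzero form `B x (e ^ m y)` on `W` is
symmetric for even `m`, and polarisation gives one generator with `σ = id`. For odd `m` it is
alternating, and two isotropic generators are swapped by `σ`; their invariants are opposite, hence
distinct. -/
lemma exists_hasDualFamilies_le [Infinite K] (hK : (2 : K) ≠ 0) (hsymm : B.IsSymm)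
    (he : ∀ u v, B (e u) v = - B u (e v)) (hnil : IsNilpotent e) {W : Submodule K V}
    (hW : ∀ x ∈ W, e x ∈ W) (hW0 : W ≠ ⊥)
    (hWnd : ∀ z ∈ W, (∀ y ∈ W, B y z = 0) → z = 0) :
    ∃ U ≤ W, U ≠ ⊥ ∧ HasDualFamilies B e U := by
  classical
  have hex : ∃ k, ∀ x ∈ W, (e ^ k) x = 0 := by
    obtain ⟨k, hk⟩ := hnil
    exact ⟨k, fun x _ => by rw [hk, LinearMap.zero_apply]⟩
  obtain ⟨m, hm⟩ : ∃ m, Nat.find hex = m + 1 := by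
    refine Nat.exists_eq_succ_of_ne_zero fun h0 => hW0 ?_
    have h1 := Nat.find_spec hex
    rw [h0] at h1
    exact (Submodule.eq_bot_iff W).2 fun x hx => by simpa using h1 x hx
  have hWm : ∀ x ∈ W, (e ^ (m + 1)) x = 0 := hm ▸ Nat.find_spec hex
  have hlt := Nat.find_min hex (m := m) (by omega)
  push Not at hlt
  obtain ⟨u, hu, hu0⟩ := hlt
  obtain ⟨u', hu', hne⟩ : ∃ u' ∈ W, B u' ((e ^ m) u) ≠ 0 := by
    by_contra hcon
    push Not at hcon
    exact hu0 (hWnd _ (pow_apply_mem hW m hu) hcon)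
  have hcyc : ∀ {ι : Type} (w : ι → V), (∀ i, w i ∈ W) → cyclicSpan e w ≤ W := fun w hw =>
    cyclicSpan_le.2 fun i s => pow_apply_mem hW s (hw i)
  have hbot : ∀ {ι : Type} (w : ι → V) (i : ι), w i ≠ 0 → cyclicSpan e w ≠ ⊥ := by
    intro ι w i hi h0
    have h1 := mem_cyclicSpan (e := e) (K := K) w i
    rw [h0] at h1
    exact hi ((Submodule.mem_bot K).1 h1)
  rcases Nat.even_or_odd m with hpar | hpar
  · obtain ⟨w, hw, hww⟩ : ∃ w ∈ W, B w ((e ^ m) w) ≠ 0 := by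
      by_contra hcon
      push Not at hcon
      have h1 := hcon _ (W.add_mem hu hu')
      have h2 : B u ((e ^ m) u') = B u' ((e ^ m) u) := by
        rw [hsymm.eq, skew_pow he, hpar.neg_one_pow, one_mul]
      simp only [map_add, LinearMap.add_apply, hcon u hu, hcon u' hu', h2] at h1
      have h3 : (2 : K) * B u' ((e ^ m) u) = 0 := by linear_combination h1
      exact hne ((mul_eq_zero.1 h3).resolve_left hK)
    refine ⟨cyclicSpan e fun _ : Unit => w, hcyc _ fun _ => hw, hbot _ () ?_,
      hasDualFamilies_of_involutive (σ := id) hK hsymm (fun _ => rfl) _ m (fun _ => hWm w hw)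
        (fun i j hij => absurd (Subsingleton.elim i j) hij) (fun _ => hww)
        (Function.injective_of_subsingleton _)⟩
    rintro rfl
    exact hww (by simp)
  · obtain ⟨w, hw, hww, hiso⟩ := exists_isotropic hK hsymm he hW hpar hWm hu hu' hne
    have hswap : ∀ x y, B x ((e ^ m) y) = - B y ((e ^ m) x) := fun x y => by
      rw [hsymm.eq, skew_pow he, hpar.neg_one_pow, neg_one_mul]
    obtain ⟨w', hw', hww', hiso'⟩ := exists_isotropic hK hsymm he hW hpar hWm hu' hw
      (by rw [hswap]; exact neg_ne_zero.2 hww)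
    have hww'' : B w' ((e ^ m) w) ≠ 0 := by rw [hswap]; exact neg_ne_zero.2 hww'
    have hdiff : B w ((e ^ m) w') ≠ B w' ((e ^ m) w) := by
      intro h1
      rw [hswap w' w] at h1
      have h2 : (2 : K) * B w ((e ^ m) w') = 0 := by linear_combination h1
      exact hww' ((mul_eq_zero.1 h2).resolve_left hK)
    refine ⟨cyclicSpan e fun b : Bool => if b then w else w',
      hcyc _ (fun b => by cases b <;> simp [hw, hw']), hbot _ true ?_,
      hasDualFamilies_of_involutive hK hsymm Bool.involutive_not _ m
        (fun b => by cases b <;> simp [hWm _ hw, hWm _ hw']) ?_ ?_ ?_⟩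
    · rintro h0
      rw [if_pos rfl] at h0
      exact hww'' (by simp [h0])
    · rintro (_ | _) (_ | _) hij s
      · exact absurd rfl hij
      · exact hiso s
      · exact hiso' s
      · exact absurd rfl hij
    · rintro (_ | _)
      · exact hww'
      · exact hww''
    · rintro (_ | _) (_ | _) hij
      · rfl
      · exact absurd hij hdiff
      · exact absurd hij hdiff.symm
      · rfl

lemma HasDualFamilies.apply_mem {W : Submodule K V} (h : HasDualFamilies B e W) {x : V}
    (hx : x ∈ W) : e x ∈ W := by
  obtain ⟨ι, _, w, v, μ, hw, -, -⟩ := h ∅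
  rw [← hw.span_left] at hx ⊢
  exact apply_mem_cyclicSpan w hx

lemma HasDualFamilies.eq_zero_of_orthogonal {W : Submodule K V} (h : HasDualFamilies B e W)
    (he : ∀ u v, B (e u) v = - B u (e v)) {z : V} (hz : z ∈ W) (hz' : ∀ y ∈ W, B y z = 0) :
    z = 0 := by
  obtain ⟨ι, _, w, v, μ, hw, -, -⟩ := h ∅
  exact hw.eq_zero_of_orthogonal he hz hz'

/-- Split off `U` from the previous lemma; its orthogonal complement in `W` is `e`-stable because
`e` is skew, and inherits nondegeneracy. -/
lemma hasDualFamilies_of_nondegenerate [Infinite K] [FiniteDimensional K V] (hK : (2 : K) ≠ 0)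
    (hsymm : B.IsSymm) (he : ∀ u v, B (e u) v = - B u (e v)) (hnil : IsNilpotent e) (d : ℕ) :
    ∀ W : Submodule K V, finrank K W = d → (∀ x ∈ W, e x ∈ W) →
      (∀ z ∈ W, (∀ y ∈ W, B y z = 0) → z = 0) → HasDualFamilies B e W := by
  induction d using Nat.strong_induction_on with
  | _ d ih =>
    intro W hd hW hWnd
    by_cases hW0 : W = ⊥
    · rw [hW0]
      exact hasDualFamilies_bot
    obtain ⟨U, hUW, hU0, hU⟩ := exists_hasDualFamilies_le hK hsymm he hnil hW hW0 hWnd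
    have hcompl : IsCompl U (B.orthogonal U) := by
      rw [LinearMap.BilinForm.isCompl_orthogonal_iff_disjoint hsymm.isRefl, Submodule.disjoint_def]
      intro z hz hz'
      exact hU.eq_zero_of_orthogonal he hz hz'
    have hsup : U ⊔ B.orthogonal U ⊓ W = W := by
      rw [← _root_.sup_inf_assoc_of_le _ hUW, hcompl.sup_eq_top, top_inf_eq]
    have hU' : HasDualFamilies B e (B.orthogonal U ⊓ W : Submodule K V) := by
      refine ih _ ?_ _ rfl ?_ ?_
      · rw [← hd]
        refine Submodule.finrank_lt_finrank_of_lt (lt_of_le_of_ne inf_le_right fun heq => hU0 ?_)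
        rw [eq_bot_iff, ← hcompl.inf_eq_bot]
        exact le_inf le_rfl (hUW.trans (inf_eq_right.1 heq))
      · rintro x ⟨hx, hx'⟩
        refine ⟨fun y hy => ?_, hW x hx'⟩
        have h1 : B (e y) x = 0 := hx (e y) (hU.apply_mem hy)
        rw [he, neg_eq_zero] at h1
        exact h1
      · rintro z ⟨hz, hz'⟩ hortho
        refine hWnd z hz' fun y hy => ?_
        rw [← hsup] at hy
        obtain ⟨a, ha, b, hb, rfl⟩ := Submodule.mem_sup.1 hy
        rw [map_add, LinearMap.add_apply, hortho b hb, add_zero]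
        exact hz a ha
    rw [← hsup]
    exact hU.sup hsymm hU' fun x hx y hy => hy.1 x hx

/-- Some functional on `𝔭_e`, extended by zero on skew maps, has radical of dimension at most
`dim V`. -/
lemma exists_finrank_radical_le [Infinite K] [FiniteDimensional K V] (hK : (2 : K) ≠ 0)
    (hsymm : B.IsSymm) (hB : B.Nondegenerate) (he : ∀ u v, B (e u) v = - B u (e v))
    (hnil : IsNilpotent e) :
    ∃ f : Dual K (End K V), (∀ x ∈ signedCentraliser B e 1, f x = 0) ∧
      finrank K (radical e f) ≤ finrank K V := by
  obtain ⟨ι, _, w, v, μ, hw, hinj, -⟩ := hasDualFamilies_of_nondegenerate hK hsymm he hnil _ ⊤ rfl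
    (fun _ _ => Submodule.mem_top)
    (fun z _ hz => hB.2 z fun y => hz y Submodule.mem_top) ∅
  refine ⟨IsDualFamily.functional B w v, fun x hx => ?_, hw.finrank_radical_le he hinj⟩
  rw [IsDualFamily.functional_apply]
  exact hw.skew x fun y z => by rw [hx.1, pow_one, neg_one_mul]

end DualFamily

end CentraliserIndex

/-! ### The index formula. -/

theorem corollary4 {K V : Type*} [Field K] [IsAlgClosed K] (hK : (2 : K) ≠ 0)
    [AddCommGroup V] [Module K V] [FiniteDimensional K V]
    (B : LinearMap.BilinForm K V) (hsymm : B.IsSymm) (hnondeg : B.Nondegenerate)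
    (e : Module.End K V) (he : e ∈ skewAdjointLieSubalgebra B) (hnil : IsNilpotent e)
    {n : ℕ} (lam : Fin n → ℕ) (hlam : CentraliserIndex.HasJordanPartition e lam) :
    (CentraliserIndex.index K (CentraliserIndex.kCentraliser B e)
        (CentraliserIndex.pCentraliser B e) : ℚ) =
      ((Module.finrank K V : ℚ) - (Fintype.card {i : Fin n // Odd (lam i)} : ℚ)) / 2 := by
  open CentraliserIndex in
  have : Infinite K := IsAlgClosed.instInfinite
  have hskew : ∀ u v, B (e u) v = - B u (e v) := fun u v => by
    have h1 : e ∈ B.skewAdjointSubmodule := he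
    simpa using (LinearMap.mem_skewAdjointSubmodule e).1 h1 u v
  have hdim := finrank_signedCentraliser_zero hK hnondeg hsymm hskew hlam
  -- The one-sided radical in `𝔭_e` exceeds the stabiliser in `𝔨_e` by the number of odd blocks.
  have key : ∀ (α : Dual K (pCentraliser B e)) (f : Dual K (End K V)),
      (∀ x ∈ signedCentraliser B e 1, f x = 0) → (∀ y : pCentraliser B e, α y = f y) →
      2 * finrank K (stabiliser K (kCentraliser B e) α) +
        Fintype.card {i : Fin n // Odd (lam i)} = finrank K (radical e f) := by
    intro α f hf hα
    rw [finrank_stabiliser_eq α f hα, finrank_radical_eq hK hnondeg hsymm hskew f hf]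
    have h1 := finrank_signedRadical_add_finrank (B := B) (e := e) f 1 0
    omega
  have hlower : ∀ α : Dual K (pCentraliser B e), finrank K V ≤
      2 * finrank K (stabiliser K (kCentraliser B e) α) +
        Fintype.card {i : Fin n // Odd (lam i)} := by
    intro α
    obtain ⟨f, hf, hα⟩ := exists_extension hK hnondeg α
    rw [key α f hf hα]
    exact finrank_le_finrank_radical e f
  obtain ⟨f, hf, hle⟩ := exists_finrank_radical_le hK hsymm hnondeg hskew hnil
  let α₀ : Dual K (pCentraliser B e) := f ∘ₗ (pCentraliser B e).toSubmodule.subtype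
  have hα₀ := key α₀ f hf fun _ => rfl
  have hlow₀ := hlower α₀
  have hindex : CentraliserIndex.index K (kCentraliser B e) (pCentraliser B e) =
      finrank K (stabiliser K (kCentraliser B e) α₀) := by
    apply le_antisymm
    · exact ciInf_le (OrderBot.bddBelow _) α₀
    · refine le_ciInf fun α => ?_
      have := hlower α
      omega
  have hfin : finrank K V = 2 * finrank K (stabiliser K (kCentraliser B e) α₀) +
      Fintype.card {i : Fin n // Odd (lam i)} := by omega
  rw [hindex, hfin]
  push_cast
  ring
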